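/- Let $F$ be a field of characteristic $0$. A \emph{$p$-valuation} on $F$ ($p$ a prime number) is a valuation on $F$ with residue characteristic $p$ and valuation ring $\mathcal{O}$ such that $d=\dim_{\mathbb{F}_p}\mathcal{O}/p\mathcal{O}$ is finite; $d$ is its $p$-rank. A \emph{prime} $\mathfrak{P}$ of $F$ is either a field ordering $\leq_{\mathfrak{P}}$ of $F$, or an equivalence class of $p$-valuations on $F$, for an arbitrary prime number $p$ and of arbitrary $p$-rank. Let $\mathcal{O}_{\mathfrak{P}}$ be the positive cone $\{x\in F: 0\leq_{\mathfrak{P}} x\}$ if $\mathfrak{P}$ is an ordering, and the valuation ring if $\mathfrak{P}$ is a $p$-valuation. A \emph{closure} of $(F,\mathfrak{P})$ is a real closure if $\mathfrak{P}$ is an ordering, and a $p$-adic closure if $\mathfrak{P}$ is a $p$-valuation, i.e. a $p$-valued algebraic extension of the same $p$-rank which has no proper $p$-valued algebraic extension of that same $p$-rank. Let $S$ be a set of primes of $F$ satisfying the denseness condition $\mathrm{D}_S$: for every monic $g\in F[X]$ and all $\mathfrak{P}\in S$ such that $g$ has a zero in some closure of $(F,\mathfrak{P})$, for every $a\in F^\times$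 there exists $x\in F$ with $1-g(x)^2a^{-2}\in\mathcal{O}_{\mathfrak{P}}$. Then the elements of $S$ are pairwise independent: any two distinct $\mathfrak{P},\mathfrak{Q}\in S$ induce distinct topologies on $F$ (where an ordering induces its order topology, and a $p$-valuation its valuation topology). -/

import Mathlib

universe u

/-- `A` is the valuation ring of a `p`-valuation of `p`-rank `d` on the field `F` of
characteristic `0`: the residue characteristic is the prime number `p`, and the `𝔽_p`-vector space
`A / pA` has finite dimension `d`, that is, it has `p ^ d` elements.
(Two valuations are equivalent exactly when their valuation rings agree, so a valuation subring is
the same thing as an equivalence class of valuations.) -/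
structure IsPValuation (p d : ℕ) {F : Type u} [Field F] (A : ValuationSubring F) : Prop where
  charZero : CharZero F
  prime : p.Prime
  not_isUnit : ¬ IsUnit (p : A)
  card_quotient : Nat.card (A ⧸ Ideal.span {(p : A)}) = p ^ d

/-- A prime of a field `F` of characteristic `0`: an ordering of the field `F`, or an equivalence
class of `p`-valuations on `F`, for an arbitrary prime number `p` and of arbitrary `p`-rank. -/
inductive FieldPrime (F : Type u) [Field F] : Type u
  | ordering (o : LinearOrder F) (ho : IsStrictOrderedRing F) : FieldPrime F
  | pval (A : ValuationSubring F) (hA : ∃ p d : ℕ, IsPValuation p d A) : FieldPrime F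

/-- The ordered field `F'` is a real closure of the ordered field `F`: it is real closed, algebraic
over `F`, and its ordering extends the one of `F`. -/
structure IsRealClosureOf (F F' : Type u) [Field F] [LinearOrder F] [IsStrictOrderedRing F]
    [Field F'] [LinearOrder F'] [IsStrictOrderedRing F'] [Algebra F F'] : Prop where
  isAlgebraic : Algebra.IsAlgebraic F F'
  isRealClosed : IsRealClosed F'
  strictMono : StrictMono (algebraMap F F')

/-- The valued field `(F', A')` is an algebraic extension of the valued field `(F, A)` and is
`p`-valued of `p`-rank `d`. -/
structure IsPValuedAlgebraicExtension (p d : ℕ) {F F' : Type u} [Field F] [Field F'] [Algebra F F']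
    (A : ValuationSubring F) (A' : ValuationSubring F') : Prop where
  isAlgebraic : Algebra.IsAlgebraic F F'
  comap_eq : A'.comap (algebraMap F F') = A
  isPValuation : IsPValuation p d A'

/-- The `p`-valued field `(F, A)` of `p`-rank `d` is `p`-adically closed: it has no proper
`p`-valued algebraic extension of the same `p`-rank. (An algebraic extension of an infinite field
`F` has the cardinality of `F`, so one universe is enough.) -/
structure IsPAdicallyClosed (p d : ℕ) {F : Type u} [Field F] (A : ValuationSubring F) :
    Prop where
  isPValuation : IsPValuation p d A
  maximal : ∀ (E : Type u) [Field E] [Algebra F E] (B : ValuationSubring E),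
    IsPValuedAlgebraicExtension p d A B → Function.Surjective (algebraMap F E)

/-- `(F', A')` is a `p`-adic closure of the `p`-valued field `(F, A)`: a `p`-valued algebraic
extension of the same `p`-rank that is `p`-adically closed. -/
def IsPAdicClosureOf {F F' : Type u} [Field F] [Field F'] [Algebra F F']
    (A : ValuationSubring F) (A' : ValuationSubring F') : Prop :=
  ∃ p d : ℕ, IsPValuation p d A ∧ IsPValuedAlgebraicExtension p d A A' ∧
    IsPAdicallyClosed p d A'

namespace FieldPrime

variable {F : Type u} [Field F]

/-- The set `𝒪_𝔓`: the positive cone `{x | 0 ≤ x}` of an ordering, the valuation ring of a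
`p`-valuation. -/
def cone : FieldPrime F → Set F
  | ordering _ _ => {x : F | 0 ≤ x}
  | pval A _ => (A : Set F)

/-- The topology on `F` induced by a prime: the order topology of an ordering, the valuation
topology of a `p`-valuation. -/
@[reducible] noncomputable def topology : FieldPrime F → TopologicalSpace F
  | ordering _ _ => Preorder.topology F
  | pval A _ => (Valued.mk' A.valuation).toUniformSpace.toTopologicalSpace

/-- The polynomial `g` has a zero in some closure of `(F, 𝔓)`, that is, in a real closure if `𝔓` is
an ordering, and in some `p`-adic closure if `𝔓` is a `p`-valuation. -/
def HasZeroInClosure (g : Polynomial F) : FieldPrime F → Prop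
  | ordering _ _ => ∃ (F' : Type u) (_ : Field F') (_ : LinearOrder F')
      (_ : IsStrictOrderedRing F') (_ : Algebra F F'),
      IsRealClosureOf F F' ∧ ∃ y : F', Polynomial.aeval y g = 0
  | pval A _ => ∃ (F' : Type u) (_ : Field F') (_ : Algebra F F') (A' : ValuationSubring F'),
      IsPAdicClosureOf A A' ∧ ∃ y : F', Polynomial.aeval y g = 0

/-- The denseness condition `D_S` for a set `S` of primes of `F`. -/
def Denseness (S : Set (FieldPrime F)) : Prop :=
  ∀ g : Polynomial F, g.Monic → ∀ P ∈ S, P.HasZeroInClosure g →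
    ∀ a : F, a ≠ 0 → ∃ x : F, 1 - (g.eval x) ^ 2 * (a ^ 2)⁻¹ ∈ P.cone

/-- Two primes are independent if they induce distinct topologies on `F`. -/
def Independent (P Q : FieldPrime F) : Prop :=
  P.topology ≠ Q.topology

end FieldPrime

/-! Suppose two distinct primes P and Q of S induce the same topology. By `Denseness`, a monic g
with a zero in a closure at P takes values in every P-neighbourhood of 0, hence in every
Q-neighbourhood. It therefore suffices to find g with a zero in a closure at P whose values stay
away from 0 at Q.

If P is an ordering, g = X² - u with 0 ≤ u at P. When Q is another ordering, take u negative at Q,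
so that g ≥ -u > 0 there. When Q is a `p`-valuation, take u to be plus or minus a uniformizer: an x
with g(x) smaller than u would make the value of u a square. The reverse mixed case follows by
symmetry.

If both are `p`-valuations, their rings are incomparable (`IsPValuation.eq_of_le`), which yields t
in the maximal ideal at P with value greater than 1 and not a square at Q. Then g = X² + X - t
works: near a zero of g at Q, x² dominates x and would have the value of t.

Zeros in closures require closures to exist. Both kinds come from Zorn's lemma inside an algebraic
closure: real closures through weighted sums of squares, `p`-adic closures through extensions that
do not change the quotient by `p`. The root of X² + X - t near 0 generates such an extension. -/

open Polynomial

/-! ### Uniformizers and comparability of `p`-valuations -/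

namespace IsPValuation

variable {p q d e : ℕ} {F : Type u} [Field F] {A B : ValuationSubring F}

theorem finite_quotient (h : IsPValuation p d A) : Finite (A ⧸ Ideal.span {(p : A)}) :=
  Nat.finite_of_card_ne_zero (h.card_quotient ▸ (pow_pos h.prime.pos d).ne')

theorem valuation_lt_one (h : IsPValuation p d A) : A.valuation (p : F) < 1 := by
  have := (A.valuation_lt_one_iff (p : A)).1 ((IsLocalRing.mem_maximalIdeal _).2 h.not_isUnit)
  simpa using this

theorem ne_zero (h : IsPValuation p d A) : (p : F) ≠ 0 := by
  have := h.charZero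
  exact_mod_cast h.prime.ne_zero

/-- Since `A / pA` is finite, two powers of `x` agree modulo `p`; their difference is `x ^ i` times
a unit, so `p` divides `x ^ i`. -/
theorem exists_pow_le (h : IsPValuation p d A) {x : F} (hx : A.valuation x < 1) :
    ∃ n : ℕ, A.valuation (x ^ n) ≤ A.valuation (p : F) := by
  have := h.finite_quotient
  let a : A := ⟨x, A.mem_of_valuation_le_one _ hx.le⟩
  obtain ⟨i, j, hij, he⟩ := Finite.exists_ne_map_eq_of_infinite
    (fun n : ℕ ↦ Ideal.Quotient.mk (Ideal.span {(p : A)}) (a ^ n))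
  wlog hlt : i < j generalizing i j
  · exact this j i hij.symm he.symm (lt_of_le_of_ne (not_lt.1 hlt) hij.symm)
  obtain ⟨k, rfl⟩ := Nat.exists_eq_add_of_lt hlt
  obtain ⟨b, hb⟩ := Ideal.mem_span_singleton.1 (Ideal.Quotient.eq.1 he)
  have hb' : x ^ i * (1 - x ^ (k + 1)) = p * b := by
    have := congrArg (fun y : A ↦ (y : F)) hb
    push_cast at this
    rw [← this]; ring
  refine ⟨i, ?_⟩
  have h1 : A.valuation (1 - x ^ (k + 1)) = 1 := by
    apply Valuation.map_one_sub_of_lt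
    rw [map_pow]
    exact pow_lt_one₀ zero_le hx (by omega)
  have := congrArg A.valuation hb'
  rw [map_mul, h1, mul_one, map_mul] at this
  rw [this]
  exact mul_le_of_le_one_right' (A.valuation_le_one b)

/-- The maximal ideal contains `pA` with finite quotient, so it is finitely generated, and finitely
generated ideals of a valuation ring are principal. -/
theorem exists_uniformizer (h : IsPValuation p d A) :
    ∃ π : F, π ≠ 0 ∧ A.valuation π < 1 ∧
      ∀ x, A.valuation x < 1 → A.valuation x ≤ A.valuation π := by
  have := h.finite_quotient
  have hfg : (IsLocalRing.maximalIdeal A).FG := by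
    refine Submodule.fg_of_fg_map_of_fg_inf_ker (Ideal.span {(p : A)}).mkQ ?_ ?_
    · exact Submodule.FG.of_finite
    · rw [Submodule.ker_mkQ, inf_eq_right.2]
      · exact ⟨{(p : A)}, by simp⟩
      · rw [Ideal.span_singleton_le_iff_mem]
        exact h.not_isUnit
  obtain ⟨π, hπ⟩ := IsBezout.isPrincipal_of_FG _ hfg
  have key (x : F) (hx : A.valuation x < 1) : A.valuation x ≤ A.valuation (π : F) := by
    have hm : (⟨x, A.mem_of_valuation_le_one _ hx.le⟩ : A) ∈ IsLocalRing.maximalIdeal A :=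
      (A.valuation_lt_one_iff _).2 hx
    rw [hπ, Submodule.mem_span_singleton] at hm
    obtain ⟨b, hb⟩ := hm
    have hb : (b : F) * π = x := congrArg (fun y : A ↦ (y : F)) hb
    rw [← hb, map_mul]
    exact mul_le_of_le_one_left' (A.valuation_le_one b)
  refine ⟨π, ?_, ?_, key⟩
  · intro h0
    have := key p h.valuation_lt_one
    rw [h0] at this
    simp [h.ne_zero] at this
  · rw [← A.valuation_lt_one_iff, hπ]
    exact Submodule.mem_span_singleton_self π

/-- A uniformizer has no square root in the value group. -/
theorem _root_.ValuationSubring.valuation_ne_sq {π : F} (h0 : π ≠ 0) (h1 : A.valuation π < 1)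
    (hmax : ∀ x, A.valuation x < 1 → A.valuation x ≤ A.valuation π) (x : F) :
    A.valuation π ≠ A.valuation x ^ 2 := by
  intro hx
  have hx1 : A.valuation x < 1 := by
    rw [hx] at h1
    exact (pow_lt_one_iff_of_nonneg zero_le two_ne_zero).1 h1
  have hx0 : 0 < A.valuation x := by
    rw [zero_lt_iff]; intro h; simp [h, h0] at hx
  have := hmax x hx1
  rw [hx, sq] at this
  exact this.not_gt (mul_lt_of_lt_one_right hx0 hx1)

/-- Comparable `p`-valuations are equal. -/
theorem eq_of_le (hA : IsPValuation p d A) (hB : IsPValuation q e B) (h : A ≤ B) : A = B := by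
  refine le_antisymm h fun b hb ↦ ?_
  by_contra hbA
  have hc : A.valuation b⁻¹ < 1 := by
    rw [← A.valuation_le_one_iff, not_le] at hbA
    rw [map_inv₀]; exact inv_lt_one_of_one_lt₀ hbA
  have hb0 : b ≠ 0 := by rintro rfl; exact hbA A.zero_mem
  obtain ⟨n, hn⟩ := hA.exists_pow_le hc
  obtain ⟨a, ha⟩ := (A.valuation_le_iff _ _).1 hn
  -- A power of `b⁻¹` is divisible by `p` in `A`; multiplying by that power of `b`, which lies in
  -- `B`, inverts `p` in `B`. So `q ≠ p`, yet both are nonunits of `A`, because the nonunits of `B`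
  -- are nonunits of `A`.
  have hpB : B.valuation (p : F) = 1 := by
    refine le_antisymm ((B.valuation_le_one_iff _).2 (natCast_mem B p)) ?_
    have h1 : 1 = a * b ^ n * (p : F) := by
      rw [mul_right_comm, ha, ← mul_pow, inv_mul_cancel₀ hb0, one_pow]
    have h2 : a * b ^ n ∈ B := mul_mem (h a.2) (pow_mem hb n)
    calc (1 : B.ValueGroup) = B.valuation (a * b ^ n * (p : F)) := by rw [← h1, map_one]
      _ ≤ B.valuation p := by
        rw [map_mul]; exact mul_le_of_le_one_left' ((B.valuation_le_one_iff _).2 h2)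
  have hqA : A.valuation (q : F) < 1 :=
    A.mem_nonunits_iff.1 (ValuationSubring.nonunits_le_nonunits.2 h
      (B.mem_nonunits_iff.2 hB.valuation_lt_one))
  by_cases hpq : p = q
  · subst hpq
    exact hB.valuation_lt_one.ne hpB
  · have := (Nat.isCoprime_iff_coprime.2 ((Nat.coprime_primes hA.prime hB.prime).2 hpq))
    obtain ⟨u, v, huv⟩ := this
    have h1 : (1 : F) = u * p + v * q := by
      simpa using congrArg (Int.cast : ℤ → F) huv.symm
    have h2 : A.valuation (u * p + v * q : F) < 1 := by
      have hz (z : ℤ) : A.valuation (z : F) ≤ 1 := (A.valuation_le_one_iff _).2 (intCast_mem A z)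
      refine A.valuation.map_add_lt ?_ ?_ <;> rw [map_mul]
      · exact (mul_le_of_le_one_left' (hz u)).trans_lt hA.valuation_lt_one
      · exact (mul_le_of_le_one_left' (hz v)).trans_lt hqA
    rw [← h1, map_one] at h2
    exact lt_irrefl _ h2

end IsPValuation

/-! ### Neighbourhoods of zero and the denseness condition -/

namespace ValuationSubring

theorem setOf_valuation_lt_mem_nhds {F : Type*} [Field F] (A : ValuationSubring F) {c : F}
    (hc : c ≠ 0) :
    {z | A.valuation z < A.valuation c} ∈
      @nhds F (Valued.mk' A.valuation).toUniformSpace.toTopologicalSpace 0 := by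
  let _ := Valued.mk' A.valuation
  refine Valued.mem_nhds_zero.2 ⟨Units.mk0 (A.valuation.restrict c) (by simpa using hc), ?_⟩
  intro z hz
  exact A.valuation.restrict_lt_iff.1 hz

theorem exists_setOf_valuation_lt_subset {F : Type*} [Field F] (A : ValuationSubring F) {U : Set F}
    (hU : U ∈ @nhds F (Valued.mk' A.valuation).toUniformSpace.toTopologicalSpace 0) :
    ∃ c : F, c ≠ 0 ∧ {z | A.valuation z < A.valuation c} ⊆ U := by
  let _ := Valued.mk' A.valuation
  obtain ⟨γ, hγ⟩ := Valued.mem_nhds_zero.1 hU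
  obtain ⟨c, hc⟩ := A.valuation_surjective (MonoidWithZeroHom.ValueGroup₀.embedding γ.1)
  refine ⟨c, ?_, fun z hz ↦ hγ ?_⟩
  · rintro rfl
    rw [map_zero, eq_comm, map_eq_zero] at hc
    exact γ.ne_zero hc
  · exact A.valuation.restrict_lt_iff_lt_embedding.2 (hc ▸ hz)

end ValuationSubring

namespace FieldPrime

variable {F : Type u} [Field F]

/-- Every neighbourhood of `0` contains a set of the form used in the denseness condition. -/
theorem exists_ne_zero_forall_mem_of_mem_nhds (P : FieldPrime F) {U : Set F}
    (hU : U ∈ @nhds F P.topology 0) :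
    ∃ a : F, a ≠ 0 ∧ ∀ z, 1 - z ^ 2 * (a ^ 2)⁻¹ ∈ P.cone → z ∈ U := by
  cases P with
  | ordering o ho =>
    let _ := Preorder.topology F
    have : OrderTopology F := ⟨rfl⟩
    obtain ⟨ε, hε, h⟩ := (nhds_basis_zero_abs_lt F).mem_iff.1 hU
    refine ⟨ε / 2, (half_pos hε).ne', fun z hz ↦ h ?_⟩
    have h2 : 0 < (ε / 2) ^ 2 := by positivity
    have hz : 0 ≤ 1 - z ^ 2 * ((ε / 2) ^ 2)⁻¹ := hz
    rw [sub_nonneg, ← div_eq_mul_inv, div_le_one h2, sq_le_sq, abs_of_pos (half_pos hε)] at hz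
    exact hz.trans_lt (half_lt_self hε)
  | pval A hA =>
    obtain ⟨p, d, hA⟩ := hA
    obtain ⟨c, hc, h⟩ := A.exists_setOf_valuation_lt_subset hU
    -- Membership in the cone bounds the value of `z` only weakly; the factor `p` makes the bound by
    -- `c` strict.
    refine ⟨c * p, mul_ne_zero hc hA.ne_zero, fun z hz ↦ h ?_⟩
    have hz : 1 - z ^ 2 * ((c * p) ^ 2)⁻¹ ∈ A := hz
    have h1 : (z / (c * p)) ^ 2 ∈ A := by
      have := A.sub_mem A.one_mem hz
      rwa [sub_sub_cancel, ← div_eq_mul_inv, ← div_pow] at this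
    rw [← A.valuation_le_one_iff, map_pow, pow_le_one_iff (by norm_num), map_div₀, map_mul] at h1
    have h0 : 0 < A.valuation c * A.valuation (p : F) := by
      simp [zero_lt_iff, hc, hA.ne_zero]
    rw [div_le_one₀ h0] at h1
    refine h1.trans_lt ?_
    exact mul_lt_of_lt_one_right (by simp [zero_lt_iff, hc]) hA.valuation_lt_one

/-- Under the denseness condition, polynomials with a zero in a closure take values in every
neighbourhood of `0`. -/
theorem Denseness.exists_eval_mem {S : Set (FieldPrime F)} (hS : Denseness S) {P Q : FieldPrime F}
    (hP : P ∈ S) (hPQ : P.topology = Q.topology) {g : F[X]} (hg : g.Monic)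
    (h0 : P.HasZeroInClosure g) {U : Set F} (hU : U ∈ @nhds F Q.topology 0) :
    ∃ x : F, g.eval x ∈ U := by
  obtain ⟨a, ha, h⟩ := P.exists_ne_zero_forall_mem_of_mem_nhds (hPQ ▸ hU)
  obtain ⟨x, hx⟩ := hS g hg P hP h0 a ha
  exact ⟨x, h _ hx⟩

end FieldPrime

/-! ### Extensions of valuation rings and their `p`-rank -/

namespace ValuationSubring

variable {F E : Type*} [Field F] [Field E] [Algebra F E] {A : ValuationSubring F}
  {B : ValuationSubring E}

theorem algebraMap_mem_iff_of_comap_eq (h : B.comap (algebraMap F E) = A) {x : F} :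
    algebraMap F E x ∈ B ↔ x ∈ A := by
  rw [← h, mem_comap]

theorem valuation_algebraMap_le_iff (h : B.comap (algebraMap F E) = A) {x y : F} :
    B.valuation (algebraMap F E x) ≤ B.valuation (algebraMap F E y) ↔
      A.valuation x ≤ A.valuation y := by
  rcases eq_or_ne y 0 with rfl | hy
  · simp
  · have h1 : 0 < A.valuation y := by simpa [zero_lt_iff] using hy
    have h2 : 0 < B.valuation (algebraMap F E y) := by simpa [zero_lt_iff] using hy
    rw [← div_le_one₀ h1, ← div_le_one₀ h2, ← map_div₀, ← map_div₀, ← map_div₀,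
      valuation_le_one_iff, valuation_le_one_iff, algebraMap_mem_iff_of_comap_eq h]

theorem valuation_algebraMap_lt_one_iff (h : B.comap (algebraMap F E) = A) {x : F} :
    B.valuation (algebraMap F E x) < 1 ↔ A.valuation x < 1 := by
  have := (valuation_algebraMap_le_iff h (x := 1) (y := x)).not
  simpa using this

/-- Every valuation subring extends to every extension field. -/
theorem exists_comap_algebraMap_eq (E : Type*) [Field E] [Algebra F E] (A : ValuationSubring F) :
    ∃ B : ValuationSubring E, B.comap (algebraMap F E) = A := by
  obtain ⟨B, hle, hloc⟩ :=
    (A.toLocalSubring.map (algebraMap F E)).exists_le_valuationSubring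
  refine ⟨B, ?_⟩
  have hA {x : F} (hx : x ∈ A) : algebraMap F E x ∈ B := hle ⟨x, hx, rfl⟩
  ext x
  rw [mem_comap]
  refine ⟨fun hx ↦ ?_, hA⟩
  rcases A.mem_or_inv_mem x with h | h
  · exact h
  rcases eq_or_ne x 0 with rfl | h0
  · exact A.zero_mem
  -- If `x` were in `B` but not in `A`, then `x⁻¹` would be a unit of `B` coming from `A`;
  -- domination forces its inverse back into `A`.
  let y : (A.toLocalSubring.map (algebraMap F E)).toSubring := ⟨algebraMap F E x⁻¹, ⟨x⁻¹, h, rfl⟩⟩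
  have hu : IsUnit (Subring.inclusion hle y) := by
    refine IsUnit.of_mul_eq_one ⟨algebraMap F E x, hx⟩ (Subtype.ext ?_)
    change algebraMap F E x⁻¹ * algebraMap F E x = 1
    rw [← map_mul, inv_mul_cancel₀ h0, map_one]
  obtain ⟨⟨_, z, hz, rfl⟩, hyz⟩ := (hloc.map_nonunit y hu).exists_right_inv
  have hyz : algebraMap F E x⁻¹ * algebraMap F E z = 1 := congrArg Subtype.val hyz
  rw [← map_mul, map_eq_one_iff _ (algebraMap F E).injective, inv_mul_eq_one₀ h0] at hyz
  exact hyz ▸ hz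

end ValuationSubring

namespace IsPValuation

variable {p d : ℕ} {F E : Type u} [Field F] [Field E] [Algebra F E] {A : ValuationSubring F}
  {B : ValuationSubring E}

/-- Injectivity of `A / pA → B / pB` is `pB ∩ A = pA`, and surjectivity is `B = A + pB`. Equality of
`p`-ranks thus becomes an elementwise condition. -/
theorem exists_quotient_ringHom (hp : (p : F) ≠ 0) (hAB : B.comap (algebraMap F E) = A) :
    ∃ f : (A ⧸ Ideal.span {(p : A)}) →+* (B ⧸ Ideal.span {(p : B)}), Function.Injective f ∧
      (Function.Surjective f ↔
        ∀ b ∈ B, ∃ a ∈ A, ∃ c ∈ B, b = algebraMap F E a + (p : E) * c) := by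
  have hp' : (p : E) ≠ 0 := by simpa using (map_ne_zero (algebraMap F E)).2 hp
  let i : A →+* B := ((algebraMap F E).comp A.subtype).codRestrict B.toSubring fun a ↦
    (ValuationSubring.algebraMap_mem_iff_of_comap_eq hAB).2 a.2
  have hi (a : A) : (i a : E) = algebraMap F E a := rfl
  have hle : Ideal.span {(p : A)} ≤ (Ideal.span {(p : B)}).comap i := by
    rw [Ideal.span_singleton_le_iff_mem, Ideal.mem_comap, map_natCast]
    exact Ideal.mem_span_singleton_self _
  refine ⟨Ideal.quotientMap _ i hle, Ideal.quotientMap_injective' fun a ha ↦ ?_, ?_⟩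
  · obtain ⟨c, hc⟩ := Ideal.mem_span_singleton.1 (Ideal.mem_comap.1 ha)
    have hc : algebraMap F E a = p * c := congrArg (fun y : B ↦ (y : E)) hc
    refine Ideal.mem_span_singleton.2 ⟨⟨(p : F)⁻¹ * a, ?_⟩, Subtype.ext ?_⟩
    · rw [← ValuationSubring.algebraMap_mem_iff_of_comap_eq hAB, map_mul, hc, map_inv₀,
        map_natCast, inv_mul_cancel_left₀ hp']
      exact c.2
    · exact (mul_inv_cancel_left₀ hp _).symm
  · constructor
    · intro h b hb
      obtain ⟨x, hx⟩ := h (Ideal.Quotient.mk _ ⟨b, hb⟩)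
      obtain ⟨a, rfl⟩ := Ideal.Quotient.mk_surjective x
      rw [Ideal.quotientMap_mk, eq_comm, Ideal.Quotient.eq] at hx
      obtain ⟨c, hc⟩ := Ideal.mem_span_singleton.1 hx
      have hc : b - algebraMap F E a = p * c := congrArg (fun y : B ↦ (y : E)) hc
      exact ⟨a, a.2, c, c.2, by rw [← hc]; ring⟩
    · intro h x
      obtain ⟨b, rfl⟩ := Ideal.Quotient.mk_surjective x
      obtain ⟨a, ha, c, hc, hb⟩ := h b b.2
      refine ⟨Ideal.Quotient.mk _ ⟨a, ha⟩, ?_⟩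
      rw [Ideal.quotientMap_mk, eq_comm, Ideal.Quotient.eq, Ideal.mem_span_singleton]
      refine ⟨⟨c, hc⟩, Subtype.ext ?_⟩
      change (b : E) - algebraMap F E a = p * c
      rw [hb]; ring

theorem of_comap_eq (hA : IsPValuation p d A) (hAB : B.comap (algebraMap F E) = A)
    (h : ∀ b ∈ B, ∃ a ∈ A, ∃ c ∈ B, b = algebraMap F E a + (p : E) * c) : IsPValuation p d B := by
  obtain ⟨f, hf, hs⟩ := exists_quotient_ringHom hA.ne_zero hAB
  have := hA.charZero
  refine ⟨charZero_of_injective_algebraMap (algebraMap F E).injective, hA.prime, ?_, ?_⟩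
  · have h1 := (ValuationSubring.valuation_algebraMap_lt_one_iff hAB).2 hA.valuation_lt_one
    change (p : B) ∈ nonunits B
    rw [← IsLocalRing.mem_maximalIdeal, B.valuation_lt_one_iff]
    simpa using h1
  · rw [← hA.card_quotient]
    exact (Nat.card_congr (Equiv.ofBijective f ⟨hf, hs.2 h⟩)).symm

theorem exists_eq_add (hA : IsPValuation p d A) (hB : IsPValuation p d B)
    (hAB : B.comap (algebraMap F E) = A) :
    ∀ b ∈ B, ∃ a ∈ A, ∃ c ∈ B, b = algebraMap F E a + (p : E) * c := by
  obtain ⟨f, hf, hs⟩ := exists_quotient_ringHom hA.ne_zero hAB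
  have := hA.finite_quotient
  have := hB.finite_quotient
  refine hs.1 (Nat.bijective_iff_injective_and_card f |>.2 ⟨hf, ?_⟩).2
  rw [hA.card_quotient, hB.card_quotient]

end IsPValuation

/-! ### Existence of `p`-adic closures -/

/-- `B` is a valuation ring of the subfield `K` of `Ω` that extends the valuation ring `A` of the
base field without changing the quotient by `p`. -/
structure IsPImmediateIn (p : ℕ) {F Ω : Type u} [Field F] [Field Ω] [Algebra F Ω]
    (A : ValuationSubring F) (K : IntermediateField F Ω) (B : Subring Ω) : Prop where
  le : ∀ x ∈ B, x ∈ K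
  mem_or_inv_mem : ∀ x ∈ K, x ∈ B ∨ x⁻¹ ∈ B
  algebraMap_mem_iff : ∀ x : F, algebraMap F Ω x ∈ B ↔ x ∈ A
  exists_eq_add : ∀ b ∈ B, ∃ a ∈ A, ∃ c ∈ B, b = algebraMap F Ω a + (p : Ω) * c

namespace IsPImmediateIn

variable {p d : ℕ} {F Ω : Type u} [Field F] [Field Ω] [Algebra F Ω]
  {A : ValuationSubring F} {K : IntermediateField F Ω} {B : Subring Ω}

/-- The valuation ring of the type `K`. -/
def valuationSubring (h : IsPImmediateIn p A K B) : ValuationSubring K :=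
  .ofSubring (B.comap K.val.toRingHom) fun x ↦ h.mem_or_inv_mem x x.2

theorem mem_valuationSubring (h : IsPImmediateIn p A K B) {x : K} :
    x ∈ h.valuationSubring ↔ (x : Ω) ∈ B := Iff.rfl

theorem comap_valuationSubring (h : IsPImmediateIn p A K B) :
    h.valuationSubring.comap (algebraMap F K) = A := by
  ext x
  exact h.algebraMap_mem_iff x

theorem isPValuation (h : IsPImmediateIn p A K B) (hA : IsPValuation p d A) :
    IsPValuation p d h.valuationSubring := by
  refine hA.of_comap_eq h.comap_valuationSubring fun b hb ↦ ?_
  obtain ⟨a, ha, c, hc, hbc⟩ := h.exists_eq_add b hb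
  refine ⟨a, ha, ⟨c, h.le c hc⟩, hc, Subtype.ext ?_⟩
  simpa using hbc

/-- Zorn's lemma for pairs ordered by inclusion: each condition on a pair tests one element at a
time, so it survives unions of chains. -/
theorem exists_maximal (h : IsPImmediateIn p A K B) :
    ∃ (K' : IntermediateField F Ω) (B' : Subring Ω), K ≤ K' ∧ IsPImmediateIn p A K' B' ∧
      ∀ K'' B'', IsPImmediateIn p A K'' B'' → K' ≤ K'' → B' ≤ B'' → K'' ≤ K' := by
  suffices H : ∃ m, (K, B) ≤ m ∧
      Maximal (· ∈ {X : IntermediateField F Ω × Subring Ω | IsPImmediateIn p A X.1 X.2}) m by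
    obtain ⟨⟨K', B'⟩, hle, hmax⟩ := H
    exact ⟨K', B', hle.1, hmax.1,
      fun K'' B'' h'' hK hB ↦ (hmax.2 (y := (K'', B'')) h'' ⟨hK, hB⟩).1⟩
  refine zorn_le_nonempty₀ _ (fun c hc hchain X hX ↦ ?_) _ h
  have : Nonempty c := ⟨⟨X, hX⟩⟩
  have hdirK : Directed (· ≤ ·) fun Y : c ↦ Y.1.1 := hchain.directed.mono_comp _ fun _ _ h ↦ h.1
  have hdirB : Directed (· ≤ ·) fun Y : c ↦ Y.1.2 := hchain.directed.mono_comp _ fun _ _ h ↦ h.2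
  have memK {x : Ω} : x ∈ (⨆ Y : c, Y.1.1) ↔ ∃ Y : c, x ∈ Y.1.1 := by
    rw [← SetLike.mem_coe, IntermediateField.coe_iSup_of_directed hdirK]; simp
  have memB {x : Ω} : x ∈ (⨆ Y : c, Y.1.2) ↔ ∃ Y : c, x ∈ Y.1.2 :=
    Subring.mem_iSup_of_directed hdirB
  refine ⟨(⨆ Y : c, Y.1.1, ⨆ Y : c, Y.1.2), ⟨fun x hx ↦ ?_, fun x hx ↦ ?_, fun x ↦ ?_,
    fun b hb ↦ ?_⟩, fun Y hY ↦ ⟨le_iSup (fun Y : c ↦ Y.1.1) ⟨Y, hY⟩,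
      le_iSup (fun Y : c ↦ Y.1.2) ⟨Y, hY⟩⟩⟩
  · obtain ⟨Y, hY⟩ := memB.1 hx
    exact memK.2 ⟨Y, (hc Y.2).le x hY⟩
  · obtain ⟨Y, hY⟩ := memK.1 hx
    exact ((hc Y.2).mem_or_inv_mem x hY).imp (fun h ↦ memB.2 ⟨Y, h⟩) fun h ↦ memB.2 ⟨Y, h⟩
  · refine ⟨fun hx ↦ ?_, fun hx ↦ memB.2 ⟨⟨X, hX⟩, ((hc hX).algebraMap_mem_iff x).2 hx⟩⟩
    obtain ⟨Y, hY⟩ := memB.1 hx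
    exact ((hc Y.2).algebraMap_mem_iff x).1 hY
  · obtain ⟨Y, hY⟩ := memB.1 hb
    obtain ⟨a, ha, e, he, hbe⟩ := (hc Y.2).exists_eq_add b hY
    exact ⟨a, ha, e, memB.2 ⟨Y, he⟩, hbe⟩

/-- A maximal element among the immediate extensions in an algebraic closure is `p`-adically
closed. -/
theorem isPAdicallyClosed [IsAlgClosed Ω] [Algebra.IsAlgebraic F Ω] (h : IsPImmediateIn p A K B)
    (hA : IsPValuation p d A)
    (hmax : ∀ K'' B'', IsPImmediateIn p A K'' B'' → K ≤ K'' → B ≤ B'' → K'' ≤ K) :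
    IsPAdicallyClosed p d h.valuationSubring := by
  refine ⟨h.isPValuation hA, fun E _ _ C hC ↦ ?_⟩
  have := hC.isAlgebraic
  let φ : E →ₐ[K] Ω := IsAlgClosed.lift
  have hφ (x : K) : φ (algebraMap K E x) = x := φ.commutes x
  have memC {x : K} : algebraMap K E x ∈ C ↔ (x : Ω) ∈ B :=
    (ValuationSubring.algebraMap_mem_iff_of_comap_eq hC.comap_eq).trans h.mem_valuationSubring
  have key : IsPImmediateIn p A (φ.fieldRange.restrictScalars F)
      (C.toSubring.map φ.toRingHom) := by
    refine ⟨?_, ?_, fun x ↦ ?_, ?_⟩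
    · rintro _ ⟨x, hx, rfl⟩
      exact ⟨x, rfl⟩
    · rintro _ ⟨x, rfl⟩
      refine (C.mem_or_inv_mem x).imp (fun hx ↦ ⟨x, hx, rfl⟩) fun hx ↦ ⟨x⁻¹, hx, ?_⟩
      exact map_inv₀ φ x
    · rw [← h.algebraMap_mem_iff]
      have hx : φ (algebraMap K E (algebraMap F K x)) = algebraMap F Ω x := hφ _
      constructor
      · rintro ⟨y, hy, hyx⟩
        have hyx : φ y = algebraMap F Ω x := hyx
        rw [← hx] at hyx
        rw [φ.toRingHom.injective hyx] at hy
        exact memC.1 hy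
      · intro hx'
        exact ⟨_, memC.2 hx', hx⟩
    · rintro _ ⟨b, hb, rfl⟩
      -- Two-step decomposition: `b = x + p c` over `K` and `x = a + p e` over `F` give `b = a + p
      -- (e + c)`.
      obtain ⟨x, hx, c, hc, hbc⟩ :=
        (h.isPValuation hA).exists_eq_add hC.isPValuation hC.comap_eq b hb
      obtain ⟨a, ha, e, he, hxe⟩ := h.exists_eq_add x hx
      refine ⟨a, ha, φ (algebraMap K E ⟨e, h.le e he⟩ + c),
        ⟨_, C.add_mem _ _ (memC.2 he) hc, rfl⟩, ?_⟩
      change φ b = _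
      rw [hbc, map_add, map_add, hφ, hφ, hxe, map_mul, map_natCast]
      ring
  intro y
  have hK : φ y ∈ K := by
    refine hmax _ _ key (fun x hx ↦ ?_) (fun x hx ↦ ?_) ⟨y, rfl⟩
    · exact ⟨algebraMap K E ⟨x, hx⟩, hφ _⟩
    · exact ⟨algebraMap K E ⟨x, h.le x hx⟩, memC.2 hx, hφ _⟩
  exact ⟨⟨φ y, hK⟩, φ.toRingHom.injective (hφ _)⟩

end IsPImmediateIn

/-- An immediate extension is contained in a `p`-adic closure. -/
theorem IsPImmediateIn.hasZeroInClosure {p d : ℕ} {F Ω : Type u} [Field F] [Field Ω] [Algebra F Ω]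
    [IsAlgClosed Ω] [Algebra.IsAlgebraic F Ω] {A : ValuationSubring F}
    {K : IntermediateField F Ω} {B : Subring Ω} (h : IsPImmediateIn p A K B)
    (hA : IsPValuation p d A) (hA' : ∃ p d : ℕ, IsPValuation p d A) {g : F[X]} {y : Ω} (hy : y ∈ K)
    (hg : aeval y g = 0) : (FieldPrime.pval A hA').HasZeroInClosure g := by
  obtain ⟨K', B', hKK', h', hmax⟩ := h.exists_maximal
  refine ⟨K', inferInstance, inferInstance, h'.valuationSubring, ⟨p, d, hA,
    ⟨inferInstance, h'.comap_valuationSubring, h'.isPValuation hA⟩,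
    h'.isPAdicallyClosed hA hmax⟩, ⟨y, hKK' hy⟩, ?_⟩
  apply K'.val.toRingHom.injective
  change K'.val (aeval _ g) = K'.val 0
  rw [← aeval_algHom_apply, map_zero]
  exact hg

/-! ### The extension generated by a root of X² + X - t -/

/-- An element of a simple extension is the value of a polynomial of degree smaller than the degree
of any monic polynomial that annihilates the generator. -/
theorem IntermediateField.exists_aeval_eq_of_mem_adjoin_simple {K L : Type*} [Field K] [Field L]
    [Algebra K L] {f : K[X]} (hf : f.Monic) (hf0 : f.natDegree ≠ 0) {y z : L} (hy : aeval y f = 0)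
    (hz : z ∈ IntermediateField.adjoin K {y}) : ∃ g : K[X], g.natDegree < f.natDegree ∧ aeval y g = z := by
  have halg : IsAlgebraic K y := ⟨f, hf.ne_zero, hy⟩
  rw [← IntermediateField.mem_toSubalgebra,
    IntermediateField.adjoin_simple_toSubalgebra_of_isAlgebraic halg,
    Algebra.adjoin_singleton_eq_range_aeval] at hz
  obtain ⟨h, rfl⟩ := hz
  refine ⟨h %ₘ f, natDegree_modByMonic_lt h hf fun h1 ↦ hf0 (by simp [h1]), ?_⟩
  exact (aeval_modByMonic_eq_self_of_root hy)

theorem IntermediateField.exists_eq_add_mul_of_mem_adjoin_simple {K L : Type*} [Field K] [Field L]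
    [Algebra K L] {f : K[X]} (hf : f.Monic) (hf2 : f.natDegree = 2) {y z : L} (hy : aeval y f = 0)
    (hz : z ∈ IntermediateField.adjoin K {y}) :
    ∃ a b : K, z = algebraMap K L a + algebraMap K L b * y := by
  obtain ⟨g, hg, rfl⟩ := exists_aeval_eq_of_mem_adjoin_simple hf (by omega) hy hz
  obtain ⟨b, a, rfl⟩ := exists_eq_X_add_C_of_natDegree_le_one (p := g) (by omega)
  exact ⟨a, b, by simp [add_comm]⟩

namespace ValuationSubring

variable {F Ω : Type u} [Field F] [Field Ω] [Algebra F Ω] {A : ValuationSubring F}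
  {W : ValuationSubring Ω} {t : F} {y : Ω}

/-- The roots `y` and `-(1 + y)` satisfy `y * (1 + y) = t`, so they cannot both have value at least
1. -/
theorem exists_root_artinSchreier [IsAlgClosed Ω] (hW : W.comap (algebraMap F Ω) = A)
    (ht : A.valuation t < 1) : ∃ y : Ω, W.valuation y < 1 ∧ y ^ 2 + y = algebraMap F Ω t := by
  have hdeg : (X ^ 2 + X - C (algebraMap F Ω t)).degree = 2 := by compute_degree!
  obtain ⟨y, hy⟩ := IsAlgClosed.exists_root (X ^ 2 + X - C (algebraMap F Ω t))
    (by rw [hdeg]; norm_num)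
  have hy : y ^ 2 + y = algebraMap F Ω t := by
    simpa [sub_eq_zero] using hy
  have ht' := (valuation_algebraMap_lt_one_iff hW).2 ht
  by_cases h : W.valuation y < 1
  · exact ⟨y, h, hy⟩
  refine ⟨-(1 + y), ?_, by rw [← hy]; ring⟩
  rw [Valuation.map_neg]
  by_contra h'
  rw [← hy, show y ^ 2 + y = y * (1 + y) by ring, map_mul] at ht'
  exact ht'.not_ge (one_le_mul (not_lt.1 h) (not_lt.1 h'))

/-- This does the work of Hensel's lemma. Up to a factor from `F`, an element of `F(y)` outside `F`
is `y - e`, and it is enough to approximate that. -/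
theorem exists_valuation_sub_lt_of_artinSchreier
    (hy1 : W.valuation y < 1) (hy : y ^ 2 + y = algebraMap F Ω t) {z : Ω}
    (hz : z ∈ IntermediateField.adjoin F {y}) (hz0 : z ≠ 0) :
    ∃ c : F, W.valuation (z - algebraMap F Ω c) < W.valuation z := by
  have main (e : F) (he0 : y - algebraMap F Ω e ≠ 0) : ∃ c : F,
      W.valuation (y - algebraMap F Ω e - algebraMap F Ω c) <
        W.valuation (y - algebraMap F Ω e) := by
    by_cases he : W.valuation (algebraMap F Ω e) < 1
    · have h1 : W.valuation (1 + algebraMap F Ω e) = 1 := Valuation.map_one_add_of_lt _ he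
      have h2 : 1 + algebraMap F Ω e ≠ 0 := fun h ↦ by simp [h] at h1
      -- With g = X² + X - t, the identity `-g(e) = (y - e) * (1 + e + y)` suggests dropping the
      -- small `y` from the last factor.
      refine ⟨-(e ^ 2 + e - t) / (1 + e), ?_⟩
      have h3 : y - algebraMap F Ω e - algebraMap F Ω (-(e ^ 2 + e - t) / (1 + e)) =
          -((y - algebraMap F Ω e) * y) / (1 + algebraMap F Ω e) := by
        simp only [map_div₀, map_neg, map_sub, map_add, map_pow, map_one, ← hy]
        field_simp
        ring
      rw [h3, map_div₀, Valuation.map_neg, map_mul, h1, div_one]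
      exact mul_lt_of_lt_one_right (by simpa [zero_lt_iff] using he0) hy1
    · refine ⟨-e, ?_⟩
      have h : W.valuation y < W.valuation (algebraMap F Ω e) := hy1.trans_le (not_lt.1 he)
      rw [map_neg, sub_neg_eq_add, sub_add_cancel, 
        Valuation.map_sub_eq_of_lt_right _ h]
      exact h
  have hdeg : (X ^ 2 + X - C t).natDegree = 2 := by compute_degree!
  obtain ⟨a, b, rfl⟩ := IntermediateField.exists_eq_add_mul_of_mem_adjoin_simple
    (f := X ^ 2 + X - C t) (by monicity!) hdeg (by simp [hy]) hz
  rcases eq_or_ne b 0 with rfl | hb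
  · refine ⟨a, ?_⟩
    simpa [zero_lt_iff] using hz0
  have hb' : algebraMap F Ω b ≠ 0 := by simpa using hb
  have hz : algebraMap F Ω a + algebraMap F Ω b * y =
      algebraMap F Ω b * (y - algebraMap F Ω (-(a / b))) := by
    simp only [map_neg, map_div₀]
    field_simp
    ring
  rw [hz] at hz0 ⊢
  obtain ⟨c, hc⟩ := main _ (right_ne_zero_of_mul hz0)
  refine ⟨b * c, ?_⟩
  rw [map_mul, ← mul_sub, map_mul, map_mul]
  exact (mul_lt_mul_iff_right₀ (by simpa [zero_lt_iff] using hb)).2 hc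

end ValuationSubring

namespace IsPValuation

variable {p d : ℕ} {F Ω : Type u} [Field F] [Field Ω] [Algebra F Ω] {A : ValuationSubring F}
  {W : ValuationSubring Ω} {K : IntermediateField F Ω}

/-- If every element of `K` is asymptotic to an element of `F`, then `F` is `p`-adically dense in
the valuation ring of `K`. -/
theorem exists_valuation_sub_le (hA : IsPValuation p d A) (hW : W.comap (algebraMap F Ω) = A)
    (hK : ∀ z ∈ K, z ≠ 0 → ∃ c : F, W.valuation (z - algebraMap F Ω c) < W.valuation z)
    {z : Ω} (hz : z ∈ K) (hz1 : z ∈ W) :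
    ∃ a ∈ A, W.valuation (z - algebraMap F Ω a) ≤ W.valuation (p : Ω) := by
  obtain ⟨π, hπ0, hπ1, hπ⟩ := hA.exists_uniformizer
  have hπ0' : algebraMap F Ω π ≠ 0 := by simpa using hπ0
  -- Asymptotic elements have equal values, so `K` has no values beyond those of `F` and `π` stays a
  -- uniformizer. Each correction below therefore gains a full factor `π`.
  have step {z : Ω} (hz : z ∈ K) (hz1 : W.valuation z < 1) :
      W.valuation z ≤ W.valuation (algebraMap F Ω π) := by
    rcases eq_or_ne z 0 with rfl | h0
    · simp
    obtain ⟨c, hc⟩ := hK z hz h0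
    have hzc := Valuation.map_eq_of_sub_lt _ ((Valuation.map_sub_swap _ _ _).trans_lt hc)
    rw [← hzc] at hz1 ⊢
    exact (ValuationSubring.valuation_algebraMap_le_iff hW).2
      (hπ _ ((ValuationSubring.valuation_algebraMap_lt_one_iff hW).1 hz1))
  have approx (n : ℕ) : ∃ a ∈ A,
      W.valuation (z - algebraMap F Ω a) ≤ W.valuation (algebraMap F Ω π) ^ n := by
    induction n with
    | zero => exact ⟨0, A.zero_mem, by simpa using (W.valuation_le_one_iff z).2 hz1⟩
    | succ n ih =>
      obtain ⟨a, ha, hza⟩ := ih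
      obtain ⟨u, hu⟩ : ∃ u, u = (z - algebraMap F Ω a) / algebraMap F Ω π ^ n := ⟨_, rfl⟩
      have hu' : z - algebraMap F Ω a = u * algebraMap F Ω π ^ n := by
        rw [hu, div_mul_cancel₀ _ (pow_ne_zero _ hπ0')]
      have huK : u ∈ K := by
        rw [hu]
        exact div_mem (sub_mem hz (K.algebraMap_mem a)) (pow_mem (K.algebraMap_mem π) n)
      have hu1 : W.valuation u ≤ 1 := by
        rw [hu, map_div₀, map_pow]
        exact div_le_one_of_le₀ hza zero_le
      obtain ⟨c, hc⟩ : ∃ c : F, W.valuation (u - algebraMap F Ω c) < 1 := by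
        rcases eq_or_ne u 0 with rfl | h0
        · exact ⟨0, by simp⟩
        · exact (hK u huK h0).imp fun c hc ↦ hc.trans_le hu1
      have hcA : c ∈ A := by
        rw [← ValuationSubring.algebraMap_mem_iff_of_comap_eq hW,
          show algebraMap F Ω c = u - (u - algebraMap F Ω c) by ring]
        exact W.toSubring.sub_mem ((W.valuation_le_one_iff _).1 hu1)
          ((W.valuation_le_one_iff _).1 hc.le)
      have hπA : π ∈ A := (A.valuation_le_one_iff _).1 hπ1.le
      refine ⟨a + c * π ^ n, add_mem ha (mul_mem hcA (pow_mem hπA n)), ?_⟩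
      have : z - algebraMap F Ω (a + c * π ^ n) =
          (u - algebraMap F Ω c) * algebraMap F Ω π ^ n := by
        rw [map_add, map_mul, map_pow, sub_mul, ← hu']
        ring
      rw [this, map_mul, map_pow, pow_succ']
      exact mul_le_mul_left (step (sub_mem huK (K.algebraMap_mem c)) hc) _
  obtain ⟨n, hn⟩ := hA.exists_pow_le hπ1
  obtain ⟨a, ha, h⟩ := approx n
  refine ⟨a, ha, h.trans ?_⟩
  rw [← map_pow, ← map_pow, ← map_natCast (algebraMap F Ω)]
  exact (ValuationSubring.valuation_algebraMap_le_iff hW).2 hn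

/-- An approximation from `A` with error at most `p` gives `W ∩ K = A + p (W ∩ K)` on dividing the
error by `p`. -/
theorem isPImmediateIn (hA : IsPValuation p d A) (hW : W.comap (algebraMap F Ω) = A)
    (hK : ∀ z ∈ K, z ≠ 0 → ∃ c : F, W.valuation (z - algebraMap F Ω c) < W.valuation z) :
    IsPImmediateIn p A K (W.toSubring ⊓ K.toSubring) := by
  have hp : (p : Ω) ≠ 0 := by
    simpa using (map_ne_zero (algebraMap F Ω)).2 hA.ne_zero
  refine ⟨fun x hx ↦ hx.2, fun x hx ↦ ?_, fun x ↦ ?_, fun b hb ↦ ?_⟩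
  · exact (W.mem_or_inv_mem x).imp (fun h ↦ ⟨h, hx⟩) fun h ↦ ⟨h, K.inv_mem hx⟩
  · rw [← ValuationSubring.algebraMap_mem_iff_of_comap_eq hW]
    exact ⟨fun h ↦ h.1, fun h ↦ ⟨h, K.algebraMap_mem x⟩⟩
  · obtain ⟨a, ha, hba⟩ := hA.exists_valuation_sub_le hW hK hb.2 hb.1
    refine ⟨a, ha, (b - algebraMap F Ω a) / p, ⟨?_, ?_⟩, ?_⟩
    · refine (W.valuation_le_one_iff _).1 ?_
      rw [map_div₀]
      exact div_le_one_of_le₀ hba zero_le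
    · exact K.div_mem (K.sub_mem hb.2 (K.algebraMap_mem a)) (natCast_mem K p)
    · field_simp
      ring

/-- If `t` lies in the maximal ideal then `X² + X - t` has a zero in some `p`-adic closure. -/
theorem hasZeroInClosure_artinSchreier (hA : IsPValuation p d A)
    (hA' : ∃ p d : ℕ, IsPValuation p d A) {t : F} (ht : A.valuation t < 1) :
    (FieldPrime.pval A hA').HasZeroInClosure (X ^ 2 + X - C t) := by
  obtain ⟨W, hW⟩ := A.exists_comap_algebraMap_eq (AlgebraicClosure F)
  obtain ⟨y, hy1, hy⟩ := ValuationSubring.exists_root_artinSchreier hW ht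
  refine (hA.isPImmediateIn hW fun z hz hz0 ↦
    ValuationSubring.exists_valuation_sub_lt_of_artinSchreier hy1 hy hz hz0).hasZeroInClosure
    hA hA' (IntermediateField.mem_adjoin_simple_self F y) ?_
  simp [hy]

end IsPValuation

/-! ### Maximal fields without -1 as a weighted sum of squares -/

section WeightedSquares

variable {F Ω : Type*} [Field F] [LinearOrder F] [IsStrictOrderedRing F] [Field Ω] [Algebra F Ω]

/-- The products of a nonnegative element of the ordered field `F` and a square of `K`. -/
def weightedSquares (K : IntermediateField F Ω) : Submonoid Ω where
  carrier := {z | ∃ a : F, 0 ≤ a ∧ ∃ k ∈ K, z = algebraMap F Ω a * k ^ 2}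
  one_mem' := ⟨1, zero_le_one, 1, K.one_mem, by simp⟩
  mul_mem' := by
    rintro _ _ ⟨a, ha, k, hk, rfl⟩ ⟨b, hb, l, hl, rfl⟩
    exact ⟨a * b, mul_nonneg ha hb, k * l, K.mul_mem hk hl, by rw [map_mul]; ring⟩

/-- The sums of squares of `K` weighted with nonnegative elements of the ordered field `F`. -/
def weightedSumSq (K : IntermediateField F Ω) : Subsemiring Ω :=
  (weightedSquares K).subsemiringClosure

variable {K : IntermediateField F Ω} {z : Ω}

theorem weightedSumSq.induction {P : Ω → Prop}
    (sq : ∀ a : F, 0 ≤ a → ∀ k ∈ K, P (algebraMap F Ω a * k ^ 2))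
    (add : ∀ x y, P x → P y → P (x + y)) (hz : z ∈ weightedSumSq K) : P z := by
  rw [weightedSumSq, Submonoid.subsemiringClosure_mem] at hz
  induction hz using AddSubmonoid.closure_induction with
  | mem x hx =>
    obtain ⟨a, ha, k, hk, rfl⟩ := hx
    exact sq a ha k hk
  | zero => simpa using sq 0 le_rfl 0 K.zero_mem
  | add x y _ _ hx hy => exact add x y hx hy

theorem mul_sq_mem_weightedSumSq {a : F} (ha : 0 ≤ a) {k : Ω} (hk : k ∈ K) :
    algebraMap F Ω a * k ^ 2 ∈ weightedSumSq K :=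
  AddSubmonoid.subset_closure ⟨a, ha, k, hk, rfl⟩

theorem sq_mem_weightedSumSq {k : Ω} (hk : k ∈ K) : k ^ 2 ∈ weightedSumSq K := by
  simpa using mul_sq_mem_weightedSumSq zero_le_one hk

theorem algebraMap_mem_weightedSumSq {a : F} (ha : 0 ≤ a) : algebraMap F Ω a ∈ weightedSumSq K := by
  simpa using mul_sq_mem_weightedSumSq ha K.one_mem

theorem weightedSumSq_le (hz : z ∈ weightedSumSq K) : z ∈ K :=
  weightedSumSq.induction (fun a _ _ hk ↦ K.mul_mem (K.algebraMap_mem a) (pow_mem hk 2))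
    (fun _ _ ↦ K.add_mem) hz

theorem neg_one_notMem_weightedSumSq_bot : (-1 : Ω) ∉ weightedSumSq (⊥ : IntermediateField F Ω) := by
  have key {z : Ω} (hz : z ∈ weightedSumSq (⊥ : IntermediateField F Ω)) :
      ∃ a : F, 0 ≤ a ∧ algebraMap F Ω a = z := by
    refine weightedSumSq.induction (P := fun z ↦ ∃ a : F, 0 ≤ a ∧ algebraMap F Ω a = z) ?_ ?_ hz
    · rintro a ha k hk
      obtain ⟨b, rfl⟩ := IntermediateField.mem_bot.1 hk
      exact ⟨a * b ^ 2, mul_nonneg ha (sq_nonneg b), by simp⟩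
    · rintro _ _ ⟨a, ha, rfl⟩ ⟨b, hb, rfl⟩
      exact ⟨a + b, add_nonneg ha hb, by simp⟩
  intro h
  obtain ⟨a, ha, h1⟩ := key h
  rw [← map_one (algebraMap F Ω), ← map_neg, (algebraMap F Ω).injective.eq_iff] at h1
  exact absurd ha (h1 ▸ not_le.2 neg_one_lt_zero)

/-- Zorn's lemma applies because a weighted sum of squares involves only finitely many elements of
the field. -/
theorem exists_maximal_neg_one_notMem_weightedSumSq (F Ω : Type*) [Field F] [LinearOrder F]
    [IsStrictOrderedRing F] [Field Ω] [Algebra F Ω] :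
    ∃ K : IntermediateField F Ω, Maximal (fun K ↦ (-1 : Ω) ∉ weightedSumSq K) K := by
  suffices H : ∃ K, ⊥ ≤ K ∧ Maximal (· ∈ {K : IntermediateField F Ω | (-1 : Ω) ∉ weightedSumSq K}) K by
    obtain ⟨K, -, hK⟩ := H
    exact ⟨K, hK⟩
  refine zorn_le_nonempty₀ _ (fun c hc hchain X hX ↦ ?_) _ neg_one_notMem_weightedSumSq_bot
  have : Nonempty c := ⟨⟨X, hX⟩⟩
  have mem_iff {x : Ω} : x ∈ (⨆ Y : c, Y.1) ↔ ∃ Y : c, x ∈ Y.1 := by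
    rw [← SetLike.mem_coe, IntermediateField.coe_iSup_of_directed hchain.directed]; simp
  have mono {K L : IntermediateField F Ω} (h : K ≤ L) {z : Ω} (hz : z ∈ weightedSumSq K) :
      z ∈ weightedSumSq L :=
    weightedSumSq.induction (fun a ha k hk ↦ mul_sq_mem_weightedSumSq ha (h hk))
      (fun _ _ ↦ add_mem) hz
  refine ⟨⨆ Y : c, Y.1, fun h ↦ ?_, fun Y hY ↦ le_iSup (fun Y : c ↦ Y.1) ⟨Y, hY⟩⟩
  obtain ⟨Y, hY⟩ : ∃ Y : c, (-1 : Ω) ∈ weightedSumSq Y.1 := by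
    refine weightedSumSq.induction (P := fun z ↦ ∃ Y : c, z ∈ weightedSumSq Y.1) ?_ ?_ h
    · intro a ha k hk
      obtain ⟨Y, hY⟩ := mem_iff.1 hk
      exact ⟨Y, mul_sq_mem_weightedSumSq ha hY⟩
    · rintro x y ⟨Y, hY⟩ ⟨Z, hZ⟩
      obtain ⟨V, hYV, hZV⟩ := hchain.directed Y Z
      exact ⟨V, add_mem (mono hYV hY) (mono hZV hZ)⟩
  exact hc Y.2 hY

theorem neg_one_mem_weightedSumSq_adjoin
    (hK : Maximal (fun K : IntermediateField F Ω ↦ (-1 : Ω) ∉ weightedSumSq K) K) {s : Ω} (hs : s ∉ K) :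
    (-1 : Ω) ∈ weightedSumSq ((IntermediateField.adjoin K {s}).restrictScalars F) := by
  by_contra h
  refine hs (hK.2 h (fun x hx ↦ ?_) (IntermediateField.mem_adjoin_simple_self K s))
  exact (IntermediateField.adjoin K {s}).algebraMap_mem ⟨x, hx⟩

/-- If `s = √x` is not in `K`, maximality gives `-1 = σ + x τ + k s` with `σ`, `τ` weighted sums of
squares. Then `k = 0` and `τ ≠ 0`, so `-x = (1 + σ) τ (τ⁻¹)²`. -/
theorem eq_sq_or_neg_mem_weightedSumSq [IsAlgClosed Ω]
    (hK : Maximal (fun K : IntermediateField F Ω ↦ (-1 : Ω) ∉ weightedSumSq K) K) {x : Ω} (hx : x ∈ K) :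
    (∃ s ∈ K, x = s ^ 2) ∨ -x ∈ weightedSumSq K := by
  obtain ⟨s, hs⟩ := IsAlgClosed.exists_pow_nat_eq x (n := 2) two_pos
  by_cases hsK : s ∈ K
  · exact .inl ⟨s, hsK, hs.symm⟩
  right
  have haeval : aeval s (X ^ 2 - C (⟨x, hx⟩ : K)) = 0 := by
    rw [map_sub, map_pow, aeval_X, aeval_C, hs]
    exact sub_self x
  have key {z : Ω} (hz : z ∈ weightedSumSq ((IntermediateField.adjoin K {s}).restrictScalars F)) :
      ∃ σ ∈ weightedSumSq K, ∃ τ ∈ weightedSumSq K, ∃ k ∈ K, z = σ + x * τ + k * s := by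
    refine weightedSumSq.induction (P := fun z ↦ ∃ σ ∈ weightedSumSq K, ∃ τ ∈ weightedSumSq K,
      ∃ k ∈ K, z = σ + x * τ + k * s) ?_ ?_ hz
    · intro a ha k hk
      obtain ⟨⟨u, hu⟩, ⟨v, hv⟩, hkuv⟩ : ∃ u v : K, k = u + v * s :=
        IntermediateField.exists_eq_add_mul_of_mem_adjoin_simple (f := X ^ 2 - C (⟨x, hx⟩ : K))
          (by monicity!) (by compute_degree!) haeval hk
      refine ⟨algebraMap F Ω a * u ^ 2, mul_sq_mem_weightedSumSq ha hu, algebraMap F Ω a * v ^ 2,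
        mul_sq_mem_weightedSumSq ha hv, 2 * algebraMap F Ω a * u * v, ?_, ?_⟩
      · exact K.mul_mem (K.mul_mem (K.mul_mem (ofNat_mem K 2) (K.algebraMap_mem a)) hu) hv
      · rw [← hs, hkuv]
        ring
    · rintro _ _ ⟨σ, hσ, τ, hτ, k, hk, rfl⟩ ⟨σ', hσ', τ', hτ', k', hk', rfl⟩
      exact ⟨_, add_mem hσ hσ', _, add_mem hτ hτ', _, add_mem hk hk', by ring⟩
  obtain ⟨σ, hσ, τ, hτ, k, hk, h⟩ := key (neg_one_mem_weightedSumSq_adjoin hK hsK)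
  have hσK := weightedSumSq_le hσ
  have hτK := weightedSumSq_le hτ
  have hk0 : k = 0 := by
    by_contra hk0
    refine hsK ?_
    have : s = (-1 - σ - x * τ) / k := by
      rw [eq_div_iff hk0, h]; ring
    rw [this]
    exact K.div_mem (K.sub_mem (K.sub_mem (K.neg_mem K.one_mem) hσK) (K.mul_mem hx hτK)) hk
  rw [hk0, zero_mul, add_zero] at h
  have hτ0 : τ ≠ 0 := by
    rintro rfl
    rw [mul_zero, add_zero] at h
    exact hK.1 (h ▸ hσ)
  have : -x = (1 + σ) * τ * (τ⁻¹) ^ 2 := by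
    field_simp
    linear_combination h
  rw [this]
  exact mul_mem (mul_mem (add_mem (one_mem _) hσ) hτ) (sq_mem_weightedSumSq (K.inv_mem hτK))

theorem eq_zero_of_mem_weightedSumSq_of_neg_mem
    (hK : Maximal (fun K : IntermediateField F Ω ↦ (-1 : Ω) ∉ weightedSumSq K) K) {x : Ω} (h : x ∈ weightedSumSq K)
    (h' : -x ∈ weightedSumSq K) : x = 0 := by
  by_contra h0
  refine hK.1 ?_
  have : (-1 : Ω) = x * (-x) * (x⁻¹) ^ 2 := by field_simp
  rw [this]
  exact mul_mem (mul_mem h h') (sq_mem_weightedSumSq (K.inv_mem (weightedSumSq_le h)))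

/-- The weighted sums of squares are a positive cone: the square-root dichotomy makes it total, and
the absence of -1 makes it proper. -/
theorem exists_linearOrder_nonneg_iff_mem_weightedSumSq [IsAlgClosed Ω]
    (hK : Maximal (fun K : IntermediateField F Ω ↦ (-1 : Ω) ∉ weightedSumSq K) K) :
    ∃ (_ : LinearOrder K) (_ : IsStrictOrderedRing K), ∀ x : K, 0 ≤ x ↔ (x : Ω) ∈ weightedSumSq K := by
  classical
  let C : RingCone K :=
    { (weightedSumSq K).comap K.val.toRingHom with
      eq_zero_of_mem_of_neg_mem' := fun {a} h h' ↦ Subtype.ext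
        (eq_zero_of_mem_weightedSumSq_of_neg_mem hK h h') }
  have hC (x : K) : x ∈ C ↔ (x : Ω) ∈ weightedSumSq K := Iff.rfl
  have : HasMemOrNegMem C := ⟨fun x ↦ by
    rcases eq_sq_or_neg_mem_weightedSumSq hK x.2 with ⟨s, hs, h⟩ | h
    · exact .inl ((hC x).2 (h ▸ sq_mem_weightedSumSq hs))
    · exact .inr h⟩
  let _ : LinearOrder K := LinearOrder.mkOfAddGroupCone C
  have : IsOrderedRing K := IsOrderedRing.mkOfCone C
  refine ⟨inferInstance, IsOrderedRing.toIsStrictOrderedRing K, fun x ↦ ?_⟩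
  rw [← hC]
  change x - 0 ∈ C ↔ _
  rw [sub_zero]

end WeightedSquares

/-! ### Roots of odd-degree polynomials and real closures -/

section OddDegree

variable {K Ω : Type*} [Field K] [LinearOrder K] [IsStrictOrderedRing K] [Field Ω] [Algebra K Ω]

/-- The zero polynomial, and the polynomials of even degree with positive leading coefficient. -/
def Polynomial.EvenPos (G : K[X]) : Prop :=
  G = 0 ∨ Even G.natDegree ∧ 0 < G.leadingCoeff

/-- Positive leading coefficients cannot cancel, so the degree of the sum is the larger of two even
degrees. -/
theorem Polynomial.EvenPos.add {G H : K[X]} (hG : G.EvenPos) (hH : H.EvenPos) :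
    (G + H).EvenPos := by
  rcases hG with rfl | ⟨hG, hG'⟩
  · simpa using hH
  rcases hH with rfl | ⟨hH, hH'⟩
  · simpa using .inr ⟨hG, hG'⟩
  right
  rcases lt_trichotomy G.natDegree H.natDegree with h | h | h
  · rw [natDegree_add_eq_right_of_natDegree_lt h,
      leadingCoeff_add_of_degree_lt (degree_lt_degree h)]
    exact ⟨hH, hH'⟩
  · have h0 : (G + H).coeff G.natDegree = G.leadingCoeff + H.leadingCoeff := by
      rw [coeff_add]; simp only [leadingCoeff, h]
    have hpos : 0 < (G + H).coeff G.natDegree := h0 ▸ add_pos hG' hH'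
    have hd : (G + H).natDegree = G.natDegree :=
      natDegree_eq_of_le_of_coeff_ne_zero ((natDegree_add_le _ _).trans (by simp [h])) hpos.ne'
    rw [leadingCoeff, hd]
    exact ⟨hG, hpos⟩
  · rw [natDegree_add_eq_left_of_natDegree_lt h,
      leadingCoeff_add_of_degree_lt' (degree_lt_degree h)]
    exact ⟨hG, hG'⟩

/-- Weighted sums of squares in a simple extension are values of polynomials without zeros whose
degree is even and bounded. -/
theorem exists_aeval_eq_of_mem_weightedSumSq_adjoin {f : K[X]} (hf : f.Monic)
    (hf0 : f.natDegree ≠ 0) {θ z : Ω} (hθ : aeval θ f = 0)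
    (hz : z ∈ weightedSumSq (IntermediateField.adjoin K {θ})) :
    ∃ G : K[X], aeval θ G = z ∧ G.natDegree ≤ 2 * (f.natDegree - 1) ∧ G.EvenPos ∧
      ∀ r, 0 ≤ G.eval r := by
  refine weightedSumSq.induction (P := fun z ↦ ∃ G : K[X], aeval θ G = z ∧
    G.natDegree ≤ 2 * (f.natDegree - 1) ∧ G.EvenPos ∧ ∀ r, 0 ≤ G.eval r) ?_ ?_ hz
  · intro a ha k hk
    obtain ⟨g, hg, rfl⟩ := IntermediateField.exists_aeval_eq_of_mem_adjoin_simple hf hf0 hθ hk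
    refine ⟨C a * g ^ 2, by simp, ?_, ?_, fun r ↦ ?_⟩
    · refine (natDegree_C_mul_le _ _).trans ?_
      rw [natDegree_pow]
      omega
    · rcases ha.eq_or_lt with rfl | ha
      · left; simp
      rcases eq_or_ne g 0 with rfl | hg0
      · left; simp
      right
      rw [natDegree_C_mul ha.ne', natDegree_pow, leadingCoeff_mul, leadingCoeff_pow, leadingCoeff_C]
      have := leadingCoeff_ne_zero.2 hg0
      exact ⟨even_two_mul _, by positivity⟩
    · rw [eval_mul, eval_C, eval_pow]
      positivity
  · rintro _ _ ⟨G, rfl, hG, hG', hG''⟩ ⟨H, rfl, hH, hH', hH''⟩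
    exact ⟨G + H, map_add _ _ _, (natDegree_add_le _ _).trans (max_le hG hH), hG'.add hH',
      fun r ↦ by rw [eval_add]; exact add_nonneg (hG'' r) (hH'' r)⟩

/-- If `-1` is a weighted sum of squares in every proper simple extension of an ordered field, then
polynomials of odd degree have a root. -/
theorem exists_isRoot_of_odd_natDegree_of_forall_mem_weightedSumSq [IsAlgClosed Ω]
    (h : ∀ θ : Ω, θ ∉ (algebraMap K Ω).range →
      (-1 : Ω) ∈ weightedSumSq (IntermediateField.adjoin K {θ}))
    {f : K[X]} (hf : Odd f.natDegree) : ∃ x, f.IsRoot x := by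
  obtain ⟨n, hn⟩ : ∃ n, n = f.natDegree := ⟨_, rfl⟩
  induction n using Nat.strong_induction_on generalizing f with
  | h n ih =>
  subst hn
  have hf0 : f ≠ 0 := by rintro rfl; simp at hf
  have hfu : ¬ IsUnit f := fun hu ↦ by simp [natDegree_eq_zero_of_isUnit hu] at hf
  by_cases hirr : Irreducible f
  · obtain ⟨θ, hθ⟩ := IsAlgClosed.exists_aeval_eq_zero Ω f
      (fun h ↦ hf.pos.ne' (natDegree_eq_of_degree_eq_some h))
    by_cases hθK : θ ∈ (algebraMap K Ω).range
    · obtain ⟨r, rfl⟩ := hθK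
      refine ⟨r, ?_⟩
      rwa [aeval_algebraMap_apply, map_eq_zero] at hθ
    have hm := minpoly.eq_of_irreducible hirr hθ
    have hlc : f.leadingCoeff⁻¹ ≠ 0 := inv_ne_zero (leadingCoeff_ne_zero.2 hf0)
    have hmdeg : (minpoly K θ).natDegree = f.natDegree := by
      rw [← hm, natDegree_mul_C hlc]
    have hint : IsIntegral K θ := IsAlgebraic.isIntegral ⟨f, hf0, hθ⟩
    -- Here `-1 = G(θ)`, so `f` divides `1 + G`, of even degree at most `2 (deg f - 1)`. The
    -- cofactor has smaller odd degree, and its root by induction contradicts `1 + G > 0`.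
    obtain ⟨G, hG, hGdeg, hGpos, hGr⟩ := exists_aeval_eq_of_mem_weightedSumSq_adjoin
      (minpoly.monic hint) (by rw [hmdeg]; exact hf.pos.ne') (minpoly.aeval K θ) (h θ hθK)
    have h1pos : (1 : K[X]).EvenPos := .inr (by simp)
    have hne (r : K) : (1 + G).eval r ≠ 0 := by
      rw [eval_add, eval_one]
      exact (add_pos_of_pos_of_nonneg one_pos (hGr r)).ne'
    have h10 : 1 + G ≠ 0 := fun h ↦ hne 0 (by simp [h])
    have heven : Even (1 + G).natDegree := ((h1pos.add hGpos).resolve_left h10).1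
    have hdvd : f ∣ 1 + G :=
      (Dvd.intro _ hm).trans (minpoly.dvd K θ (by simp [hG]))
    obtain ⟨H, hH⟩ := hdvd
    have hH0 : H ≠ 0 := by rintro rfl; exact h10 (by simp [hH])
    have hdeg : (1 + G).natDegree = f.natDegree + H.natDegree := by
      rw [hH, natDegree_mul hf0 hH0]
    have hle : (1 + G).natDegree ≤ 2 * (f.natDegree - 1) := by
      refine (natDegree_add_le _ _).trans (max_le (by simp) (hmdeg ▸ hGdeg))
    have hHodd : Odd H.natDegree := by
      rw [hdeg] at heven
      exact (Nat.even_add'.1 heven).1 hf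
    have hpos := hf.pos
    obtain ⟨r, hr⟩ := ih H.natDegree (by omega) hHodd rfl
    exact absurd (by rw [hH, eval_mul, hr.eq_zero, mul_zero]) (hne r)
  · obtain ⟨g, h', hg, hh, rfl⟩ : ∃ g h', ¬ IsUnit g ∧ ¬ IsUnit h' ∧ f = g * h' := by
      by_contra! hcon
      refine hirr ⟨hfu, fun a b hab ↦ ?_⟩
      by_contra! hab'
      exact hcon a b hab'.1 hab'.2 hab
    have hg0 := left_ne_zero_of_mul hf0
    have hh0 := right_ne_zero_of_mul hf0
    have hgd : 0 < g.natDegree := natDegree_pos_iff_degree_pos.2 (degree_pos_of_ne_zero_of_nonunit hg0 hg)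
    have hhd : 0 < h'.natDegree := natDegree_pos_iff_degree_pos.2 (degree_pos_of_ne_zero_of_nonunit hh0 hh)
    rw [natDegree_mul hg0 hh0] at ih hf
    rcases Nat.even_or_odd g.natDegree with he | ho
    · obtain ⟨r, hr⟩ := ih _ (by omega) ((Nat.odd_add'.1 hf).2 he) rfl
      exact ⟨r, by simp [hr.eq_zero]⟩
    · obtain ⟨r, hr⟩ := ih _ (by omega) ho rfl
      exact ⟨r, by simp [hr.eq_zero]⟩

end OddDegree

/-- Every ordered field has a real closure. -/
theorem exists_isRealClosureOf (F : Type u) [Field F] [LinearOrder F] [IsStrictOrderedRing F] :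
    ∃ (F' : Type u) (_ : Field F') (_ : LinearOrder F') (_ : IsStrictOrderedRing F')
      (_ : Algebra F F'), IsRealClosureOf F F' := by
  let Ω := AlgebraicClosure F
  obtain ⟨K, hK⟩ := exists_maximal_neg_one_notMem_weightedSumSq F Ω
  obtain ⟨o, ho, hnonneg⟩ := exists_linearOrder_nonneg_iff_mem_weightedSumSq hK
  have hmap {a : F} (ha : 0 ≤ a) : 0 ≤ algebraMap F K a :=
    (hnonneg _).2 (algebraMap_mem_weightedSumSq ha)
  refine ⟨K, inferInstance, o, ho, inferInstance, ⟨inferInstance, ?_, ?_⟩⟩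
  · refine .of_linearOrderedField (fun {x} hx ↦ ?_) fun hf ↦ ?_
    · rcases eq_sq_or_neg_mem_weightedSumSq hK x.2 with ⟨s, hs, h⟩ | h
      · exact ⟨⟨s, hs⟩, Subtype.ext (h.trans (sq s))⟩
      · have := eq_zero_of_mem_weightedSumSq_of_neg_mem hK ((hnonneg x).1 hx) h
        rw [show x = 0 from Subtype.ext this]
        exact IsSquare.zero
    · refine exists_isRoot_of_odd_natDegree_of_forall_mem_weightedSumSq (Ω := Ω) (fun θ hθ ↦ ?_) hf
      have hθK : θ ∉ K := fun h ↦ hθ ⟨⟨θ, h⟩, rfl⟩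
      -- Weights from `F` are nonnegative in the order of `K`, so the representation of -1 over `F`
      -- is also one over `K`.
      refine weightedSumSq.induction (fun a ha k hk ↦ ?_) (fun _ _ ↦ add_mem)
        (neg_one_mem_weightedSumSq_adjoin hK hθK)
      rw [IsScalarTower.algebraMap_apply F K Ω]
      exact mul_sq_mem_weightedSumSq (hmap ha) hk
  · refine Monotone.strictMono_of_injective (fun a b hab ↦ ?_) (algebraMap F K).injective
    rw [← sub_nonneg, ← map_sub]
    exact hmap (sub_nonneg.2 hab)

/-- Positive elements have a square root in a real closure. -/
theorem FieldPrime.hasZeroInClosure_X_sq_sub_C {F : Type u} [Field F] (o : LinearOrder F)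
    (ho : IsStrictOrderedRing F) {u : F} (hu : 0 ≤ u) :
    (FieldPrime.ordering o ho).HasZeroInClosure (X ^ 2 - C u) := by
  obtain ⟨F', i1, i2, i3, i4, h⟩ := exists_isRealClosureOf F
  refine ⟨F', i1, i2, i3, i4, h, ?_⟩
  have := h.isRealClosed
  have hu' : 0 ≤ algebraMap F F' u := by
    rw [← map_zero (algebraMap F F')]
    exact h.strictMono.monotone hu
  obtain ⟨y, hy⟩ := IsSquare.of_nonneg hu'
  exact ⟨y, by simp [hy, sq]⟩

/-! ### Separating two primes by a polynomial -/

theorem LinearOrder.exists_nonneg_and_neg_of_ne {F : Type*} [Field F] {o o' : LinearOrder F}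
    (ho : @IsStrictOrderedRing F _ o.toPartialOrder)
    (ho' : @IsStrictOrderedRing F _ o'.toPartialOrder) (h : o ≠ o') :
    ∃ u : F, o.le 0 u ∧ o'.lt u 0 := by
  by_contra! hcon
  have hle {a b : F} (hab : o.le a b) : o'.le a b := by
    have h1 : o.le 0 (b - a) := by
      let _ := o
      exact sub_nonneg.2 hab
    have h2 := hcon _ h1
    let _ := o'
    exact sub_nonneg.1 h2
  refine h (LinearOrder.ext fun a b ↦ ⟨hle, fun hab ↦ ?_⟩)
  rcases o.le_total a b with h1 | h1
  · exact h1
  · exact o'.le_antisymm a b hab (hle h1) ▸ o.le_refl a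

namespace FieldPrime

variable {F : Type u} [Field F] {S : Set (FieldPrime F)}

theorem Denseness.independent_ordering_ordering (hS : Denseness S) {o o' : LinearOrder F}
    {ho : @IsStrictOrderedRing F _ o.toPartialOrder}
    {ho' : @IsStrictOrderedRing F _ o'.toPartialOrder}
    (hP : ordering o ho ∈ S) (hne : o ≠ o') : Independent (ordering o ho) (ordering o' ho') := by
  intro htop
  obtain ⟨u, hu, hu'⟩ := LinearOrder.exists_nonneg_and_neg_of_ne ho ho' hne
  have hU : {z | o'.lt z (-u)} ∈ @nhds F (ordering o' ho').topology 0 := by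
    clear htop hu hP hne
    let _ := Preorder.topology F
    have : OrderTopology F := ⟨rfl⟩
    exact Iio_mem_nhds (neg_pos.2 hu')
  obtain ⟨x, hx⟩ := hS.exists_eval_mem hP htop (monic_X_pow_sub_C u two_ne_zero)
    (hasZeroInClosure_X_sq_sub_C o ho hu) hU
  clear htop hU hu hP hne ho
  have hx : eval x (X ^ 2 - C u) < -u := hx
  rw [eval_sub, eval_pow, eval_X, eval_C, sub_eq_add_neg, add_lt_iff_neg_right] at hx
  exact hx.not_ge (sq_nonneg x)

/-- A uniformizer can be made nonnegative by a sign change, which does not affect its value; that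
value is not a square. -/
theorem Denseness.independent_ordering_pval (hS : Denseness S) {o : LinearOrder F}
    {ho : @IsStrictOrderedRing F _ o.toPartialOrder} {A : ValuationSubring F}
    {hA : ∃ p d : ℕ, IsPValuation p d A}
    (hP : ordering o ho ∈ S) : Independent (ordering o ho) (pval A hA) := by
  intro htop
  obtain ⟨p, d, hA'⟩ := hA
  obtain ⟨π, hπ0, hπ1, hπ⟩ := hA'.exists_uniformizer
  obtain ⟨u, hu, hu0, huv⟩ : ∃ u : F, 0 ≤ u ∧ u ≠ 0 ∧ A.valuation u = A.valuation π := by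
    rcases le_total 0 π with h | h
    · exact ⟨π, h, hπ0, rfl⟩
    · exact ⟨-π, neg_nonneg.2 h, neg_ne_zero.2 hπ0, A.valuation.map_neg π⟩
  obtain ⟨x, hx⟩ := hS.exists_eval_mem hP htop (monic_X_pow_sub_C u two_ne_zero)
    (hasZeroInClosure_X_sq_sub_C o ho hu) (A.setOf_valuation_lt_mem_nhds hu0)
  have hx : A.valuation (eval x (X ^ 2 - C u)) < A.valuation u := hx
  rw [eval_sub, eval_pow, eval_X, eval_C] at hx
  have := Valuation.map_eq_of_sub_lt _ hx
  rw [map_pow, huv] at this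
  exact A.valuation_ne_sq hπ0 hπ1 hπ x this.symm

theorem Denseness.independent_pval_pval (hS : Denseness S) {A B : ValuationSubring F}
    {hA : ∃ p d : ℕ, IsPValuation p d A} {hB : ∃ p d : ℕ, IsPValuation p d B}
    (hP : pval A hA ∈ S) (hne : A ≠ B) : Independent (pval A hA) (pval B hB) := by
  intro htop
  have hA₀ := hA
  have hB₀ := hB
  obtain ⟨p, d, hA'⟩ := hA₀
  obtain ⟨q, e, hB'⟩ := hB₀
  obtain ⟨a, haA, haB⟩ := SetLike.not_le_iff_exists.1 fun h ↦ hne (hA'.eq_of_le hB' h)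
  obtain ⟨b, hbB, hbA⟩ := SetLike.not_le_iff_exists.1 fun h ↦ hne (hB'.eq_of_le hA' h).symm
  rw [← ValuationSubring.valuation_le_one_iff] at haA hbB
  rw [← ValuationSubring.valuation_le_one_iff, not_le] at haB hbA
  have hsA : A.valuation (a / b) < 1 := by
    rw [map_div₀, div_lt_one₀ (zero_lt_one.trans hbA)]
    exact haA.trans_lt hbA
  have hsB : 1 < B.valuation (a / b) := by
    have hb0 : b ≠ 0 := by rintro rfl; simp at hbA
    rw [map_div₀, one_lt_div₀ (by simpa [zero_lt_iff] using hb0)]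
    exact hbB.trans_lt haB
  obtain ⟨s, hs⟩ : ∃ s, s = a / b := ⟨_, rfl⟩
  rw [← hs] at hsA hsB
  have hs0 : s ≠ 0 := by rintro rfl; simp at hsB
  obtain ⟨π, hπ0, hπ1, hπ⟩ := hB'.exists_uniformizer
  have hsq := B.valuation_ne_sq hπ0 hπ1 hπ
  -- Since `s⁻¹` is in the maximal ideal of `B`, its value is at most that of `π`. Hence `s ^ 2 * π`
  -- still has value greater than 1.
  have hsπ : 1 ≤ B.valuation s * B.valuation π := by
    have := hπ s⁻¹ (by rw [map_inv₀]; exact inv_lt_one_of_one_lt₀ hsB)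
    rwa [map_inv₀, inv_le_iff_one_le_mul₀' (zero_lt_one.trans hsB)] at this
  have hsA2 : A.valuation (s ^ 2) < 1 := by
    rw [map_pow]; exact pow_lt_one₀ zero_le hsA two_ne_zero
  have hπpos : 0 < B.valuation π := by simpa [zero_lt_iff] using hπ0
  -- Multiplying or dividing `s ^ 2` by `π` makes its value at `B` a nonsquare; the choice depends
  -- on which keeps the value at `A` below 1.
  obtain ⟨t, htA, htB, htsq⟩ : ∃ t, A.valuation t < 1 ∧ 1 < B.valuation t ∧
      ∀ x, B.valuation t ≠ B.valuation x ^ 2 := by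
    rcases le_total (A.valuation π) 1 with h | h
    · refine ⟨s ^ 2 * π, ?_, ?_, fun x hx ↦ hsq (x / s) ?_⟩
      · rw [map_mul]; exact (mul_le_of_le_one_right' h).trans_lt hsA2
      · rw [map_mul, map_pow, sq, mul_assoc]
        exact hsB.trans_le (le_mul_of_one_le_right' hsπ)
      · rw [← map_pow, div_pow, map_div₀, map_pow _ x, ← hx, ← map_div₀]
        congr 1
        field_simp
    · refine ⟨s ^ 2 / π, ?_, ?_, fun x hx ↦ hsq (s / x) ?_⟩
      · rw [map_div₀, div_lt_one₀ (zero_lt_one.trans_le h)]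
        exact hsA2.trans_le h
      · rw [map_div₀, one_lt_div₀ hπpos, map_pow]
        exact hπ1.trans (one_lt_pow₀ hsB two_ne_zero)
      · rw [← map_pow, div_pow, map_div₀, map_pow _ x, ← hx, ← map_div₀]
        congr 1
        field_simp
  have ht0 : t ≠ 0 := by rintro rfl; simp at htA htB
  have hmonic : (X ^ 2 + X - C t).Monic := by monicity!
  obtain ⟨x, hx⟩ := hS.exists_eval_mem hP htop hmonic
    (hA'.hasZeroInClosure_artinSchreier hA htA) (B.setOf_valuation_lt_mem_nhds ht0)
  have hx : B.valuation (eval x (X ^ 2 + X - C t)) < B.valuation t := hx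
  rw [eval_sub, eval_add, eval_pow, eval_X, eval_C] at hx
  have hxt := Valuation.map_eq_of_sub_lt _ hx
  -- As `x ^ 2 + x` has the value of `t`, which exceeds 1, `x` is not in `B`; so `x ^ 2` dominates
  -- and the value of `t` is a square.
  have hx1 : 1 < B.valuation x := by
    by_contra! h
    rw [← hxt] at htB
    refine htB.not_ge (B.valuation.map_add_le ?_ h)
    rw [map_pow]
    exact pow_le_one₀ zero_le h
  refine htsq x (hxt.symm.trans ?_)
  rw [← map_pow]
  refine Valuation.map_add_eq_of_lt_left _ ?_
  rw [map_pow]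
  exact lt_self_pow₀ hx1 one_lt_two

end FieldPrime

theorem mainTheorem11 {F : Type u} [Field F] [CharZero F] (S : Set (FieldPrime F))
    (hS : FieldPrime.Denseness S) :
    S.Pairwise FieldPrime.Independent := by
  intro P hP Q hQ hne
  cases P with
  | ordering o ho =>
    cases Q with
    | ordering o' ho' => exact hS.independent_ordering_ordering hP fun h ↦ hne (by subst h; rfl)
    | pval B hB => exact hS.independent_ordering_pval hP
  | pval A hA =>
    cases Q with
    | ordering o' ho' => exact (hS.independent_ordering_pval hQ).symm
    | pval B hB => exact hS.independent_pval_pval hP fun h ↦ hne (by subst h; rfl)
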